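/- Let $A$ be a commutative ring with finitely many maximal ideals and, for a maximal ideal $\mathfrak{m} \subset A$, set $k_{\mathfrak{m}} := A/\mathfrak{m}$. Let $C$ be an affine scheme that is smooth of pure relative dimension $1$ over $A$, let $Y \subset C$ be a closed subscheme that is quasi-finite over $A$, and, for each maximal ideal $\mathfrak{m} \subset A$, let $\iota_{\mathfrak{m}} \colon Y_{k_{\mathfrak{m}}} \hookrightarrow \mathbb{A}^1_{k_{\mathfrak{m}}}$ be a closed immersion over $k_{\mathfrak{m}}$, where $Y_{k_{\mathfrak{m}}} := Y \times_{\operatorname{Spec} A} \operatorname{Spec} k_{\mathfrak{m}}$. Then there are an affine open $C' \subset C$ containing $Y_{k_{\mathfrak{m}}}$ for every maximal ideal $\mathfrak{m} \subset A$, an affine open $V \subset \mathbb{A}^1_A$, an étale $A$-morphism $f \colon C' \to V$, and a closed subscheme $Y' \subset V$ such that $f$ restricts to an isomorphism $Y \cap C' \xrightarrow{\sim} Y'$ and the square $$\begin{array}{ccc} Y \cap C' & \hookrightarrow & C' \\ {\scriptstyle\sim}\downarrow & & \downarrow {\scriptstyle f} \\ Y' & \hookrightarrow & V \end{array}$$ is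 Cartesian. -/

import Mathlib

open CategoryTheory CategoryTheory.Limits AlgebraicGeometry

universe u

noncomputable section

namespace Reembed

/-- The affine line `𝔸¹` over `Spec R`. -/
abbrev affineLine (R : Type u) [CommRing R] : Scheme.{u} :=
  𝔸(PUnit.{u + 1}; Spec (CommRingCat.of R))

/-- The structure morphism of the affine line over `Spec R`. -/
abbrev affineLineToSpec (R : Type u) [CommRing R] :
    affineLine R ⟶ Spec (CommRingCat.of R) :=
  𝔸(PUnit.{u + 1}; Spec (CommRingCat.of R)) ↘ Spec (CommRingCat.of R)

variable {A : Type u} [CommRing A]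

/-- The closed point `Spec k_𝔪 ⟶ Spec A`, where `k_𝔪 = A ⧸ 𝔪`. -/
abbrev closedPoint (m : MaximalSpectrum A) :
    Spec (CommRingCat.of (A ⧸ m.asIdeal)) ⟶ Spec (CommRingCat.of A) :=
  Spec.map (CommRingCat.ofHom (Ideal.Quotient.mk m.asIdeal))

/-- The closed fibre `X_{k_𝔪} = X ×_{Spec A} Spec k_𝔪` of an `A`-scheme `p : X ⟶ Spec A`. -/
abbrev closedFibre {X : Scheme.{u}} (p : X ⟶ Spec (CommRingCat.of A))
    (m : MaximalSpectrum A) : Scheme.{u} :=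
  pullback p (closedPoint m)

/-- The canonical morphism `X_{k_𝔪} ⟶ X`. -/
abbrev closedFibreι {X : Scheme.{u}} (p : X ⟶ Spec (CommRingCat.of A))
    (m : MaximalSpectrum A) : closedFibre p m ⟶ X :=
  pullback.fst p (closedPoint m)

/-- The structure morphism `X_{k_𝔪} ⟶ Spec k_𝔪`. -/
abbrev closedFibreToSpec {X : Scheme.{u}} (p : X ⟶ Spec (CommRingCat.of A))
    (m : MaximalSpectrum A) :
    closedFibre p m ⟶ Spec (CommRingCat.of (A ⧸ m.asIdeal)) :=
  pullback.snd p (closedPoint m)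

end Reembed

end

/-!
Put `C = Spec B`, `Y = Spec S` with `S = B ⧸ I`, and let `J` be the intersection of the finitely
many maximal ideals. A closed immersion of a closed fibre of `Y` into the affine line is a generator
of that fibre, and the Chinese remainder theorem glues these to one generator `t` of `S ⧸ J S`. By
Zariski's main theorem `t` can be altered modulo `J S`, on a neighbourhood of the closed fibres, so
that `S` becomes integral over `A[t]`; Nakayama's lemma then makes `Y` a closed subscheme of the
affine line near these fibres. Lift `t` to `B`. Over the Artinian ring
`B ⧸ (I + J B)` the rank one module `Ω[B⁄A]` is generated by `D t` together with the differentials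
of the elements of `I`, so a stable-range argument yields `s ∈ I` for which `D (t + s)` alone
generates it, and then it does so near the closed fibres. There `t + s` is an étale map to the
affine line that agrees with `t` on `Y`. The preimage of the image of `Y` contains `Y` as an open
and closed subscheme, and inverting an element that is `1` on `Y` and `0` on its complement makes
the square Cartesian.
-/

noncomputable section

namespace Reembed

open Polynomial TensorProduct
open KaehlerDifferential (D span_range_derivation)

section ChineseRemainder

variable {A S ι : Type*} [CommRing A] [CommRing S] {I : ι → Ideal A}

theorem pairwise_isCoprime_map (hI : Pairwise (Function.onFun IsCoprime I)) (f : A →+* S) :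
    Pairwise (Function.onFun IsCoprime fun i ↦ (I i).map f) :=
  fun _ _ hij ↦ (hI hij).map (Ideal.mapHom f)

variable [Finite ι]

theorem isArtinianRing_quotient_iInf (hI : Pairwise (Function.onFun IsCoprime I))
    [∀ i, IsArtinianRing (A ⧸ I i)] : IsArtinianRing (A ⧸ ⨅ i, I i) :=
  (Ideal.quotientInfRingEquivPiQuotient I hI).symm.surjective.isArtinianRing

theorem map_iInf_of_pairwise_isCoprime (hI : Pairwise (Function.onFun IsCoprime I)) (f : A →+* S) :
    (⨅ i, I i).map f = ⨅ i, (I i).map f := by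
  have := Fintype.ofFinite ι
  have hprod := Ideal.prod_eq_iInf_of_pairwise_isCoprime (s := .univ) (hI.set_pairwise _)
  have hprod_map := Ideal.prod_eq_iInf_of_pairwise_isCoprime (s := .univ)
    ((pairwise_isCoprime_map hI f).set_pairwise _)
  simp only [Finset.mem_univ, iInf_pos] at hprod hprod_map
  rw [← hprod, ← hprod_map]
  exact map_prod (Ideal.mapHom f) _ _

end ChineseRemainder

section Generators

variable {A S : Type*} [CommRing A] [CommRing S] [Algebra A S]

theorem algHom_mem_map {T : Type*} [CommRing T] [Algebra A T] (f : S →ₐ[A] T) {J : Ideal A} {x : S}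
    (hx : x ∈ J.map (algebraMap A S)) : f x ∈ J.map (algebraMap A T) := by
  rw [← f.comp_algebraMap, ← Ideal.map_map]
  exact Ideal.mem_map_of_mem _ hx

/-- The class of `t` generates `S ⧸ K` as an `A`-algebra, in other words it is the coordinate of a
closed immersion of `Spec (S ⧸ K)` into the affine line over `A`. -/
def IsGeneratorMod (A : Type*) {S : Type*} [CommRing A] [CommRing S] [Algebra A S]
    (K : Ideal S) (t : S) : Prop :=
  ∀ s, ∃ p : A[X], s - aeval t p ∈ K

theorem sub_aeval_mem_of_sub_mem {K : Ideal S} {s t t' : S} {p p' : A[X]}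
    (hs : s - aeval t p ∈ K) (ht : t' - t ∈ K) (hp : aeval t' (p' - p) ∈ K) :
    s - aeval t' p' ∈ K := by
  have hsub : aeval t' p - aeval t p ∈ K :=
    Ideal.mem_of_dvd _ (by simpa using sub_dvd_eval_sub t' t (p.map (algebraMap A S))) ht
  rw [map_sub] at hp
  convert sub_mem (sub_mem hs hsub) hp using 1
  ring

theorem IsGeneratorMod.of_sub_mem {K : Ideal S} {t t' : S} (h : IsGeneratorMod A K t)
    (ht : t' - t ∈ K) : IsGeneratorMod A K t' := fun s ↦
  have ⟨p, hp⟩ := h s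
  ⟨p, sub_aeval_mem_of_sub_mem hp ht (by simp)⟩

theorem exists_isGeneratorMod_map_iInf {ι : Type*} [Finite ι] {I : ι → Ideal A}
    (hI : Pairwise (Function.onFun IsCoprime I))
    (h : ∀ i, ∃ t : S, IsGeneratorMod A ((I i).map (algebraMap A S)) t) :
    ∃ t : S, IsGeneratorMod A ((⨅ i, I i).map (algebraMap A S)) t := by
  choose τ hτ using h
  obtain ⟨t, ht⟩ := Ideal.exists_forall_sub_mem_ideal (pairwise_isCoprime_map hI _) τ
  refine ⟨t, fun s ↦ ?_⟩
  choose q hq using fun i ↦ hτ i s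
  obtain ⟨p, hp⟩ := Ideal.exists_forall_sub_mem_ideal (pairwise_isCoprime_map hI C) q
  rw [map_iInf_of_pairwise_isCoprime hI]
  refine ⟨p, Submodule.mem_iInf _ |>.2 fun i ↦ sub_aeval_mem_of_sub_mem (hq i) (ht i) ?_⟩
  exact algHom_mem_map (aeval t) (hp i)

end Generators

section ZariskiMainTheorem

variable {A S : Type*} [CommRing A] [CommRing S] [Algebra A S]

/-- The ideal of the elements `b` of the integral closure `A'` of `A` in `S` such that
`A'[1/b] = S[1/b]`, in the form: every `x : S` has `b ^ n * x` integral for some `n`. -/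
def conductorRadical (A S : Type*) [CommRing A] [CommRing S] [Algebra A S] :
    Ideal (integralClosure A S) :=
  ⨅ x : S, ((1 : Submodule (integralClosure A S) S).colon {x}).radical

theorem mem_conductorRadical {b : integralClosure A S} :
    b ∈ conductorRadical A S ↔ ∀ x, ∃ n : ℕ, IsIntegral A ((b : S) ^ n * x) := by
  simp [conductorRadical, Submodule.mem_iInf, Ideal.mem_radical_iff, Submodule.mem_colon_singleton,
    Submodule.mem_one, Algebra.smul_def, mem_integralClosure_iff]

theorem map_conductorRadical_eq_top [Algebra.FiniteType A S] [Algebra.QuasiFinite A S] :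
    (conductorRadical A S).map (algebraMap (integralClosure A S) S) = ⊤ := by
  by_contra hne
  obtain ⟨P, hP, hle⟩ := Ideal.exists_le_maximal _ hne
  obtain ⟨b, hbP, hb, hbx⟩ := Algebra.zariskisMainProperty_iff.mp
    (Algebra.ZariskisMainProperty.of_finiteType (R := A) P)
  exact hbP (hle (Ideal.mem_map_of_mem (algebraMap (integralClosure A S) S)
    (mem_conductorRadical.2 hbx : ⟨b, hb⟩ ∈ conductorRadical A S)))

theorem isIntegral_quotient_map_of_quasiFinite [Algebra.QuasiFinite A S] (J : Ideal A)
    [IsArtinianRing (A ⧸ J)] : Algebra.IsIntegral A (S ⧸ J.map (algebraMap A S)) := by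
  have : Algebra.QuasiFinite (A ⧸ J) (S ⧸ J.map (algebraMap A S)) := .of_restrictScalars A _ _
  have : Module.Finite (A ⧸ J) (S ⧸ J.map (algebraMap A S)) := .of_quasiFinite
  exact .trans (A ⧸ J)

theorem exists_sub_one_mem_and_isIntegral_pow_mul [Algebra.FiniteType A S]
    [Algebra.QuasiFinite A S] (J : Ideal A) [IsArtinianRing (A ⧸ J)] :
    ∃ b : S, b - 1 ∈ J.map (algebraMap A S) ∧ ∀ x, ∃ n : ℕ, IsIntegral A (b ^ n * x) := by
  let f := algebraMap (integralClosure A S) (S ⧸ J.map (algebraMap A S))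
  have hf : f.IsIntegral := RingHom.IsIntegral.tower_top (algebraMap A (integralClosure A S)) f
    (isIntegral_quotient_map_of_quasiFinite J).isIntegral
  have htop : (conductorRadical A S ⊔ RingHom.ker f).map f = ⊤ := by
    rw [eq_top_iff, ← Ideal.map_top (Ideal.Quotient.mk _), ← map_conductorRadical_eq_top (A := A),
      Ideal.map_map]
    exact Ideal.map_mono le_sup_left
  rw [Ideal.map_eq_top_iff_of_ker_le f le_sup_right hf, Ideal.eq_top_iff_one,
    Submodule.mem_sup] at htop
  obtain ⟨b, hb, z, hz, hbz⟩ := htop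
  refine ⟨b, Ideal.Quotient.eq.1 ?_, mem_conductorRadical.1 hb⟩
  have : f b = f 1 := by rw [← hbz, map_add, (hz : f z = 0), add_zero]
  exact this

end ZariskiMainTheorem

section PuncturedGenerator

variable {A S : Type*} (S₁ : Type*) [CommRing A] [CommRing S] [CommRing S₁] [Algebra A S]
  [Algebra A S₁] [Algebra S S₁] [IsScalarTower A S S₁] {b : S} [IsLocalization.Away b S₁]

theorem IsGeneratorMod.of_away {J : Ideal A} {t : S} (hb : b - 1 ∈ J.map (algebraMap A S))
    (ht : IsGeneratorMod A (J.map (algebraMap A S)) t) :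
    IsGeneratorMod A (J.map (algebraMap A S₁)) (algebraMap S S₁ t) := by
  intro x
  obtain ⟨k, s, hs⟩ := IsLocalization.Away.surj b x
  obtain ⟨p, hp⟩ := ht s
  refine ⟨p, ?_⟩
  have hmem {y : S} (hy : y ∈ J.map (algebraMap A S)) :
      algebraMap S S₁ y ∈ J.map (algebraMap A S₁) :=
    algHom_mem_map (IsScalarTower.toAlgHom A S S₁) hy
  have hbk : algebraMap S S₁ (b ^ k) - 1 ∈ J.map (algebraMap A S₁) := by
    rw [← map_one (algebraMap S S₁), ← map_sub]
    exact hmem (Ideal.mem_of_dvd _ (by simpa using sub_dvd_pow_sub_pow b 1 k) hb)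
  have := sub_mem (hmem hp) (Ideal.mul_mem_left _ x hbk)
  rw [map_sub, ← hs, ← aeval_algebraMap_apply, map_pow] at this
  convert this using 1
  ring

theorem isIntegral_aeval_of_away {t : S₁} {s : S} (hs : IsIntegral A s)
    (ht : t = algebraMap S S₁ s - 1 + IsLocalization.Away.invSelf b)
    (hint : ∀ x, ∃ n : ℕ, IsIntegral A (b ^ n * x)) :
    (aeval t : A[X] →ₐ[A] S₁).toRingHom.IsIntegral := by
  let := (aeval t : A[X] →ₐ[A] S₁).toRingHom.toAlgebra
  have : IsScalarTower A A[X] S₁ := .of_algebraMap_eq' (aeval t).comp_algebraMap.symm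
  have hmap {y : S} (hy : IsIntegral A y) : IsIntegral A[X] (algebraMap S S₁ y) :=
    hy.algebraMap.tower_top
  have hinv : IsIntegral A[X] (IsLocalization.Away.invSelf b : S₁) := by
    have hX : IsIntegral A[X] t := by
      simpa only [RingHom.algebraMap_toAlgebra, AlgHom.toRingHom_eq_coe, RingHom.coe_coe, aeval_X]
        using isIntegral_algebraMap (R := A[X]) (A := S₁) (x := X)
    convert (hX.add isIntegral_one).sub (hmap hs) using 1
    rw [ht]
    ring
  intro x
  obtain ⟨k, y, hy⟩ := IsLocalization.Away.surj b x
  obtain ⟨m, hm⟩ := hint y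
  have hx : x = algebraMap S S₁ (b ^ m * y) * IsLocalization.Away.invSelf b ^ (m + k) := by
    have hb : algebraMap S S₁ b * IsLocalization.Away.invSelf b = 1 :=
      IsLocalization.Away.mul_invSelf b
    calc x = x * (algebraMap S S₁ b * IsLocalization.Away.invSelf b) ^ (m + k) := by simp [hb]
      _ = _ := by rw [map_mul, ← hy, map_pow]; ring
  rw [hx]
  exact (hmap hm).mul (hinv.pow _)

variable (b) in
/-- The new generator is `b ^ n * t - 1 + 1 / b`. It is congruent to `t` because `b` is congruent
to `1`, and its pole along the removed locus `{b = 0}` keeps it a finite map. -/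
theorem exists_isGeneratorMod_and_isIntegral_aeval (J : Ideal A)
    (hb : b - 1 ∈ J.map (algebraMap A S)) (hint : ∀ x, ∃ n : ℕ, IsIntegral A (b ^ n * x)) {t : S}
    (ht : IsGeneratorMod A (J.map (algebraMap A S)) t) :
    ∃ t₁ : S₁, IsGeneratorMod A (J.map (algebraMap A S₁)) t₁ ∧
      (aeval t₁ : A[X] →ₐ[A] S₁).toRingHom.IsIntegral := by
  obtain ⟨n, hn⟩ := hint t
  let β : S₁ := IsLocalization.Away.invSelf b
  let g := algebraMap S S₁
  refine ⟨g (b ^ n * t) - 1 + β, (ht.of_away S₁ hb).of_sub_mem ?_,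
    isIntegral_aeval_of_away S₁ hn rfl hint⟩
  have hmem {y : S} (hy : b - 1 ∣ y) : g y ∈ J.map (algebraMap A S₁) :=
    algHom_mem_map (IsScalarTower.toAlgHom A S S₁) (Ideal.mem_of_dvd _ hy hb)
  have hβ : g b * β = 1 := IsLocalization.Away.mul_invSelf b
  have hpow : b - 1 ∣ b ^ n - 1 := by simpa using sub_dvd_pow_sub_pow b 1 n
  have hsplit : g (b ^ n * t) - 1 + β - g t = g (b ^ n - 1) * g t - g (b - 1) * β := by
    simp only [map_mul, map_sub, map_one]
    linear_combination hβ
  rw [hsplit]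
  exact sub_mem (Ideal.mul_mem_right _ _ (hmem hpow)) (Ideal.mul_mem_right _ _ (hmem dvd_rfl))

end PuncturedGenerator

section Differentials

theorem exists_mem_isUnit_add {T : Type*} [CommRing T] [Finite (MaximalSpectrum T)] {N : Ideal T}
    {u : T} (h : N ⊔ Ideal.span {u} = ⊤) : ∃ d ∈ N, IsUnit (u + d) := by
  classical
  obtain ⟨d₀, hd₀, z, hz, hdz⟩ := Submodule.mem_sup.1 ((Ideal.eq_top_iff_one _).1 h)
  obtain ⟨y, hy⟩ := Ideal.exists_forall_sub_mem_ideal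
    (I := fun M : MaximalSpectrum T ↦ M.asIdeal)
    (fun M M' hne ↦ Ideal.isCoprime_of_isMaximal fun heq ↦ hne (MaximalSpectrum.ext heq))
    fun M ↦ if u ∈ M.asIdeal then 1 else 0
  refine ⟨y * d₀, N.mul_mem_left y hd₀, ?_⟩
  by_contra hunit
  obtain ⟨M, hM, hmem⟩ := exists_max_ideal_of_mem_nonunits hunit
  specialize hy ⟨M, hM⟩
  by_cases hu : u ∈ M
  · have hzM : z ∈ M := M.span_singleton_le_iff_mem.2 hu hz
    have hy1 : y - 1 ∈ M := by simpa [hu] using hy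
    refine hM.ne_top ((Ideal.eq_top_iff_one _).2 ?_)
    have hyd : y * d₀ ∈ M := (M.add_mem_iff_right hu).1 hmem
    have : 1 = z + (y * d₀ - (y - 1) * d₀) := by linear_combination -hdz
    rw [this]
    exact add_mem hzM (sub_mem hyd (M.mul_mem_right _ hy1))
  · have hy0 : y ∈ M := by simpa [hu] using hy
    exact hu ((M.add_mem_iff_left (M.mul_mem_right _ hy0)).1 hmem)

section Derivation

variable {A B N : Type*} [CommRing A] [CommRing B] [Algebra A B] [AddCommGroup N] [Module A N]
  [Module B N]

theorem derivation_mem_smul_top [IsScalarTower A B N] (d : Derivation A B N) {J : Ideal A} {x : B}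
    (hx : x ∈ J.map (algebraMap A B)) : d x ∈ J.map (algebraMap A B) • (⊤ : Submodule B N) := by
  induction hx using Submodule.span_induction with
  | mem x hx =>
    obtain ⟨a, -, rfl⟩ := hx
    rw [Derivation.map_algebraMap]
    exact zero_mem _
  | zero => rw [map_zero]; exact zero_mem _
  | add x y _ _ hx hy => rw [map_add]; exact add_mem hx hy
  | smul b x hx h =>
    rw [smul_eq_mul, Derivation.leibniz]
    exact add_mem (Submodule.smul_mem _ b h) (Submodule.smul_mem_smul hx trivial)

theorem IsGeneratorMod.derivation_mem {K : Ideal B} {t : B} (h : IsGeneratorMod A K t)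
    (d : Derivation A B N) {W : Submodule B N} (ht : d t ∈ W) (hK : ∀ x ∈ K, d x ∈ W) (x : B) :
    d x ∈ W := by
  obtain ⟨p, hp⟩ := h x
  rw [← sub_add_cancel x (aeval t p), map_add, Derivation.map_aeval]
  exact add_mem (hK _ hp) (W.smul_mem _ ht)

theorem exists_mem_derivation_eq_of_mem_span {I K : Ideal B} (hIK : I ≤ K)
    (d : Derivation A B (B ⧸ K)) {z : B ⧸ K} (hz : z ∈ Ideal.span (d '' I)) :
    ∃ s ∈ I, d s = z := by
  induction hz using Submodule.span_induction with
  | mem _ hz => exact hz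
  | zero => exact ⟨0, zero_mem _, map_zero d⟩
  | add _ _ _ _ hz hz' =>
    obtain ⟨s, hs, rfl⟩ := hz
    obtain ⟨s', hs', rfl⟩ := hz'
    exact ⟨s + s', add_mem hs hs', map_add d s s'⟩
  | smul c _ _ hz =>
    obtain ⟨s, hs, rfl⟩ := hz
    obtain ⟨b, rfl⟩ := Ideal.Quotient.mk_surjective c
    refine ⟨b * s, I.mul_mem_left b hs, ?_⟩
    have hzero : s • d b = 0 := by
      rw [Algebra.smul_def, Ideal.Quotient.algebraMap_eq, Ideal.Quotient.eq_zero_iff_mem.2 (hIK hs),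
        zero_mul]
    rw [Derivation.leibniz, hzero, add_zero]
    rfl

theorem IsGeneratorMod.exists_mem_isUnit_derivation_add {J : Ideal A} {I K : Ideal B} {t : B}
    (ht : IsGeneratorMod A K t) (hK : K = I ⊔ J.map (algebraMap A B))
    [Finite (MaximalSpectrum (B ⧸ K))] (d : Derivation A B (B ⧸ K))
    (hd : Submodule.span B (Set.range d) = ⊤) : ∃ s ∈ I, IsUnit (d (t + s)) := by
  let W : Ideal (B ⧸ K) := Ideal.span (d '' I) ⊔ Ideal.span {d t}
  have hmemW : ∀ x, d x ∈ W.restrictScalars B := by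
    refine ht.derivation_mem d (Ideal.mem_sup_right (Ideal.mem_span_singleton_self _)) fun x hx ↦ ?_
    obtain ⟨s, hs, j, hj, rfl⟩ := Submodule.mem_sup.1 (hK ▸ hx)
    have hdj : d j = 0 := by
      have hle : J.map (algebraMap A B) • (⊤ : Submodule B (B ⧸ K)) ≤ ⊥ := by
        refine Submodule.smul_le.2 fun b hb n _ ↦ ?_
        rw [Algebra.smul_def, Ideal.Quotient.algebraMap_eq,
          Ideal.Quotient.eq_zero_iff_mem.2 (hK ▸ Ideal.mem_sup_right hb), zero_mul]
        exact zero_mem _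
      exact hle (derivation_mem_smul_top d hj)
    rw [map_add, hdj, add_zero]
    exact Ideal.mem_sup_left (Ideal.subset_span ⟨s, hs, rfl⟩)
  have hW : W = ⊤ := by
    rw [← Submodule.restrictScalars_eq_top_iff B, eq_top_iff, ← hd, Submodule.span_le]
    exact Set.range_subset_iff.2 hmemW
  obtain ⟨z, hz, hunit⟩ := exists_mem_isUnit_add hW
  obtain ⟨s, hs, rfl⟩ := exists_mem_derivation_eq_of_mem_span (hK ▸ le_sup_left) d hz
  exact ⟨s, hs, by rwa [map_add]⟩

end Derivation

theorem exists_surjective_ker_eq_smul_top {B M : Type*} [CommRing B] [AddCommGroup M] [Module B M]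
    [Module.Finite B M] [Module.Flat B M] (hrk : ∀ p, Module.rankAtStalk (R := B) M p = 1)
    (K : Ideal B) [Finite (MaximalSpectrum (B ⧸ K))] :
    ∃ ε : M →ₗ[B] B ⧸ K, Function.Surjective ε ∧ LinearMap.ker ε = K • ⊤ := by
  let T := B ⧸ K
  obtain ⟨b⟩ : Nonempty (Module.Basis (Fin 1) T (T ⊗[B] M)) := by
    refine Module.nonempty_basis_of_flat_of_finrank_eq T _ 1 fun P ↦ ?_
    let := Ideal.Quotient.field P.asIdeal
    have hrank := Module.rankAtStalk_baseChange (R := T) (M := T ⊗[B] M) (S := T ⧸ P.asIdeal) ⊥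
    rwa [Module.rankAtStalk_baseChange (R := B), hrk,
      Module.rankAtStalk_eq_finrank_of_free] at hrank
  let e : (M ⧸ K • (⊤ : Submodule B M)) ≃ₗ[B] T := (quotTensorEquivQuotSMul M K).symm ≪≫ₗ
    (b.repr ≪≫ₗ Finsupp.uniqueLinearEquiv T T (0 : Fin 1)).restrictScalars B
  refine ⟨e.toLinearMap ∘ₗ (K • (⊤ : Submodule B M)).mkQ,
    e.surjective.comp (Submodule.mkQ_surjective _), ?_⟩
  rw [LinearEquiv.ker_comp, Submodule.ker_mkQ]

theorem IsGeneratorMod.exists_smul_mem_span_D_add {A B : Type*} [CommRing A]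
    [CommRing B] [Algebra A B] [Module.Finite B Ω[B⁄A]] [Module.Flat B Ω[B⁄A]]
    (hrk : ∀ p, Module.rankAtStalk (R := B) Ω[B⁄A] p = 1) {J : Ideal A} {I K : Ideal B} {t : B}
    (ht : IsGeneratorMod A K t) (hK : K = I ⊔ J.map (algebraMap A B))
    [Finite (MaximalSpectrum (B ⧸ K))] :
    ∃ s ∈ I, ∃ h : B, h - 1 ∈ K ∧ ∀ ω : Ω[B⁄A], h • ω ∈ Submodule.span B {D A B (t + s)} := by
  obtain ⟨ε, hε, hker⟩ := exists_surjective_ker_eq_smul_top hrk K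
  have hspan : Submodule.span B (Set.range (ε.compDer (D A B))) = ⊤ := by
    rw [← LinearMap.range_eq_top.2 hε, LinearMap.range_eq_map, ← span_range_derivation,
      Submodule.map_span, ← Set.range_comp]
    rfl
  obtain ⟨s, hs, hunit⟩ := ht.exists_mem_isUnit_derivation_add hK _ hspan
  obtain ⟨v, hv⟩ : ∃ v, v * ε (D A B (t + s)) = 1 := hunit.exists_left_inv
  have hsup : ⊤ ≤ Submodule.span B {D A B (t + s)} ⊔ K • (⊤ : Submodule B Ω[B⁄A]) := by
    intro ω _
    obtain ⟨c, hc⟩ := Ideal.Quotient.mk_surjective (ε ω * v)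
    refine Submodule.mem_sup.2 ⟨c • D A B (t + s),
      Submodule.smul_mem _ _ (Submodule.mem_span_singleton_self _), ω - c • D A B (t + s), ?_,
      add_sub_cancel _ _⟩
    rw [← hker, LinearMap.mem_ker, map_sub, map_smul, sub_eq_zero, Algebra.smul_def,
      Ideal.Quotient.algebraMap_eq, hc, mul_assoc, hv, mul_one]
  obtain ⟨h, hh, hle⟩ := Submodule.exists_sub_one_mem_and_smul_le_of_fg_of_le_sup
    Module.Finite.fg_top le_rfl hsup
  exact ⟨s, hs, h, hh, fun ω ↦ hle (Submodule.smul_mem_pointwise_smul ω h ⊤ trivial)⟩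

end Differentials

section EtaleCriterion

theorem smul_kaehlerDifferential_eq_zero {A R B : Type*} [CommRing A] [CommRing R] [CommRing B]
    [Algebra A R] [Algebra A B] [Algebra R B] [IsScalarTower A R B] {x : R} {h : B}
    (hspan : ∀ ω : Ω[B⁄A], h • ω ∈ Submodule.span B {D A B (algebraMap R B x)}) (ω : Ω[B⁄R]) :
    h • ω = 0 := by
  obtain ⟨ω, rfl⟩ := KaehlerDifferential.map_surjective A R B ω
  obtain ⟨c, hc⟩ := Submodule.mem_span_singleton.1 (hspan ω)
  have := congr_arg (KaehlerDifferential.map A R B B) hc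
  rw [map_smul, map_smul, KaehlerDifferential.map_D, Algebra.algebraMap_self, RingHom.id_apply,
    Derivation.map_algebraMap, smul_zero] at this
  exact this.symm

variable {A R B L : Type u} [CommRing A] [CommRing R] [CommRing B] [CommRing L] [Algebra A R]
  [Algebra A B] [Algebra A L] [Algebra R L] [Algebra B L] [IsScalarTower A R L]
  [IsScalarTower A B L]

theorem formallyUnramified_of_smul_kaehlerDifferential_eq_zero [Algebra.FormallyEtale B L] {h : B}
    (hunit : IsUnit (algebraMap B L h)) (hzero : ∀ ω : Ω[B⁄A], h • ω = 0) :
    Algebra.FormallyUnramified A L := by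
  suffices h0 : ∀ z : L ⊗[B] Ω[B⁄A], z = 0 from
    have : Subsingleton (L ⊗[B] Ω[B⁄A]) := subsingleton_of_forall_eq 0 h0
    ⟨(KaehlerDifferential.tensorKaehlerEquivOfFormallyEtale A B L).symm.injective.subsingleton⟩
  intro z
  induction z using TensorProduct.induction_on with
  | zero => rfl
  | add y z hy hz => rw [hy, hz, add_zero]
  | tmul c ω =>
    rw [← hunit.smul_eq_zero, algebraMap_smul, ← TensorProduct.tmul_smul, hzero, tmul_zero]

theorem rankAtStalk_kaehlerDifferential_of_formallyEtale [Algebra.FormallyEtale B L]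
    [Module.Finite B Ω[B⁄A]] [Module.Flat B Ω[B⁄A]] (q : PrimeSpectrum L) :
    Module.rankAtStalk (R := L) Ω[L⁄A] q =
      Module.rankAtStalk (R := B) Ω[B⁄A] (q.comap (algebraMap B L)) := by
  rw [← Module.rankAtStalk_eq_of_equiv
    (KaehlerDifferential.tensorKaehlerEquivOfFormallyEtale A B L), Module.rankAtStalk_baseChange]

theorem rankAtStalk_kaehlerDifferential_polynomial (p : PrimeSpectrum A[X]) :
    Module.rankAtStalk (R := A[X]) Ω[A[X]⁄A] p = 1 := by
  have := p.nontrivial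
  rw [Module.rankAtStalk_eq_of_equiv (KaehlerDifferential.polynomialEquiv A),
    Module.rankAtStalk_self]
  rfl

theorem etale_of_formallyUnramified_of_rankAtStalk_eq [Algebra.Smooth A R] [Algebra.Smooth A L]
    [Algebra.FormallyUnramified R L]
    (hrk : ∀ q : PrimeSpectrum L, Module.rankAtStalk (R := L) Ω[L⁄A] q =
      Module.rankAtStalk (R := R) Ω[R⁄A] (q.comap (algebraMap R L))) :
    Algebra.Etale R L := by
  have hsurj : Function.Surjective (KaehlerDifferential.mapBaseChange A R L) := fun ω ↦
    (KaehlerDifferential.exact_mapBaseChange_map A R L ω).1 (Subsingleton.elim _ _)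
  have hbij : Function.Bijective (KaehlerDifferential.mapBaseChange A R L) :=
    Module.bijective_of_surjective_of_rankAtStalk_eq hsurj fun m hm ↦ by
      rw [Module.rankAtStalk_baseChange, hrk]
  have hH1 : Subsingleton (Algebra.H1Cotangent R L) := by
    refine subsingleton_of_forall_eq 0 fun x ↦ ?_
    have hδ : Algebra.H1Cotangent.δ A R L x = 0 := by
      refine hbij.1 ?_
      rw [map_zero]
      exact (Algebra.H1Cotangent.exact_δ_mapBaseChange A R L _).2 ⟨x, rfl⟩
    obtain ⟨y, rfl⟩ := (Algebra.H1Cotangent.exact_map_δ A R L x).1 hδ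
    rw [Subsingleton.elim y 0, map_zero]
  exact ⟨⟨inferInstance, hH1⟩, .of_restrict_scalars_finitePresentation A R L⟩

theorem etale_away_polynomial (r : A[X]) [Algebra (Localization.Away r) L]
    [IsScalarTower A (Localization.Away r) L] [Algebra.Smooth A L]
    [Algebra.FormallyUnramified (Localization.Away r) L]
    (hrk : ∀ q, Module.rankAtStalk (R := L) Ω[L⁄A] q = 1) :
    Algebra.Etale (Localization.Away r) L := by
  have : Algebra.Etale A[X] (Localization.Away r) := .of_isLocalizationAway r
  have : Algebra.Smooth A A[X] := ⟨inferInstance, inferInstance⟩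
  have : Algebra.Smooth A (Localization.Away r) := .comp A A[X] _
  refine etale_of_formallyUnramified_of_rankAtStalk_eq (A := A) fun q ↦ ?_
  rw [hrk, rankAtStalk_kaehlerDifferential_of_formallyEtale (B := A[X]),
    rankAtStalk_kaehlerDifferential_polynomial]

end EtaleCriterion

section EtaleNeighbourhoods

theorem exists_sub_one_mem_and_forall_smul_eq_algebraMap {R S : Type*} [CommRing R] [CommRing S]
    [Algebra R S] [Module.Finite R S] {I : Ideal R}
    (hI : ∀ x : S, ∃ p : R, x - algebraMap R S p ∈ I.map (algebraMap R S)) :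
    ∃ r : R, r - 1 ∈ I ∧ ∀ x : S, ∃ p : R, r • x = algebraMap R S p := by
  have hsup : ⊤ ≤ LinearMap.range (Algebra.linearMap R S) ⊔ I • (⊤ : Submodule R S) := by
    intro x _
    obtain ⟨p, hp⟩ := hI x
    refine Submodule.mem_sup.2 ⟨algebraMap R S p, ⟨p, rfl⟩, x - algebraMap R S p, ?_,
      add_sub_cancel _ _⟩
    rwa [Ideal.smul_top_eq_map]
  obtain ⟨r, hr, hle⟩ := Submodule.exists_sub_one_mem_and_smul_le_of_fg_of_le_sup
    Module.Finite.fg_top le_rfl hsup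
  refine ⟨r, hr, fun x ↦ ?_⟩
  obtain ⟨p, hp⟩ := hle (Submodule.smul_mem_pointwise_smul x r ⊤ trivial)
  exact ⟨p, hp.symm⟩

theorem surjective_algebraMap_of_away {R S R' S' : Type*} [CommRing R] [CommRing S] [CommRing R']
    [CommRing S'] [Algebra R S] [Algebra R R'] [Algebra R S'] [Algebra S S'] [Algebra R' S']
    [IsScalarTower R S S'] [IsScalarTower R R' S'] {r : R} [IsLocalization.Away r R']
    [IsLocalization.Away (algebraMap R S r) S'] (hr : ∀ y : S, ∃ p, r • y = algebraMap R S p) :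
    Function.Surjective (algebraMap R' S') := by
  intro x
  obtain ⟨n, y, hy⟩ := IsLocalization.Away.surj (algebraMap R S r) x
  obtain ⟨p, hp⟩ := hr y
  have hinv : algebraMap R R' r * IsLocalization.Away.invSelf r = 1 :=
    IsLocalization.Away.mul_invSelf r
  have hinv' : algebraMap R S' r * algebraMap R' S' (IsLocalization.Away.invSelf r) = 1 := by
    rw [IsScalarTower.algebraMap_apply R R' S', ← map_mul, hinv, map_one]
  have hxp : algebraMap R S' p = x * algebraMap R S' r ^ (n + 1) := by
    rw [IsScalarTower.algebraMap_apply R S S' p, ← hp, Algebra.smul_def, map_mul, ← hy,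
      ← IsScalarTower.algebraMap_apply]
    ring
  refine ⟨algebraMap R R' p * IsLocalization.Away.invSelf r ^ (n + 1), ?_⟩
  rw [map_mul, map_pow, ← IsScalarTower.algebraMap_apply, hxp, mul_assoc, ← mul_pow, hinv', one_pow,
    mul_one]

theorem isLocalization_away_quotient_map {L L' : Type*} [CommRing L] [CommRing L'] [Algebra L L']
    (I : Ideal L) (w : L) [IsLocalization.Away w L'] :
    IsLocalization.Away (Ideal.Quotient.mk I w) (L' ⧸ I.map (algebraMap L L')) := by
  rw [IsLocalization.Away, ← Submonoid.map_powers]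
  exact inferInstanceAs (IsLocalization (Algebra.algebraMapSubmonoid (L ⧸ I) (.powers w)) _)

/-- The kernel of the multiplication of an unramified algebra is generated by an idempotent, so the
two points `L → L ⧸ 𝔞 L` given by the quotient map and by `L → L ⧸ I ≃ R ⧸ 𝔞` coincide on an open
and closed subset. -/
theorem exists_sub_one_mem_and_forall_mul_mem_map_under {R L : Type*} [CommRing R] [CommRing L]
    [Algebra R L] [Algebra.FormallyUnramified R L] [Algebra.EssFiniteType R L] {I : Ideal L}
    (hI : Function.Surjective (algebraMap R (L ⧸ I))) :
    ∃ w, w - 1 ∈ I ∧ ∀ x ∈ I, w * x ∈ (I.under R).map (algebraMap R L) := by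
  let J := (I.under R).map (algebraMap R L)
  have hJI : J ≤ I := Ideal.map_comap_le
  let ρ : L ⧸ J →ₐ[R] L ⧸ I := Ideal.Quotient.factorₐ R hJI
  let retr : L ⧸ I →ₐ[R] L ⧸ J :=
    AlgHom.liftOfSurjective (Algebra.ofId R (L ⧸ I)) hI (Algebra.ofId R (L ⧸ J)) fun r hr ↦ by
      rw [RingHom.mem_ker] at hr ⊢
      exact Ideal.Quotient.eq_zero_iff_mem.2
        (Ideal.mem_map_of_mem (algebraMap R L) (Ideal.Quotient.eq_zero_iff_mem (I := I) |>.1 hr))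
  have hρ : ρ.comp retr = AlgHom.id R (L ⧸ I) := by
    ext x
    obtain ⟨r, rfl⟩ := hI x
    simp
  let σ : L →ₐ[R] L ⧸ J := retr.comp (Ideal.Quotient.mkₐ R I)
  let Φ : L ⊗[R] L →ₐ[R] L ⧸ J :=
    Algebra.TensorProduct.lift (Ideal.Quotient.mkₐ R J) σ fun _ _ ↦ .all _ _
  have hΦ : ρ.comp Φ = (Ideal.Quotient.mkₐ R I).comp (Algebra.TensorProduct.lmul' R) := by
    ext x
    · simp [Φ, ρ]
    · simpa [Φ, σ] using DFunLike.congr_fun hρ (Ideal.Quotient.mk I x)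
  obtain ⟨w, hw⟩ := Ideal.Quotient.mk_surjective (Φ (Algebra.FormallyUnramified.elem R L))
  refine ⟨w, Ideal.Quotient.eq.1 ?_, fun x hx ↦ Ideal.Quotient.eq_zero_iff_mem.1 ?_⟩
  · have := DFunLike.congr_fun hΦ (Algebra.FormallyUnramified.elem R L)
    simpa [← hw, ρ, Algebra.FormallyUnramified.lmul_elem] using this
  · have hσx : σ x = 0 := by simp [σ, Ideal.Quotient.eq_zero_iff_mem.2 hx]
    have := congr_arg Φ (Algebra.FormallyUnramified.one_tmul_mul_elem (R := R) x)
    simp only [map_mul, ← hw] at this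
    simpa [Φ, hσx, mul_comm, eq_comm] using this

/-- `Spec L` is an étale neighbourhood of the zero locus of `I` over `Spec R`: it is étale over
`Spec R`, and `Spec (L ⧸ I)` is the preimage of a closed subscheme of `Spec R` to which it maps
isomorphically. -/
structure IsEtaleNeighbourhood (R : Type*) {L : Type*} [CommRing R] [CommRing L] [Algebra R L]
    (I : Ideal L) : Prop where
  etale : Algebra.Etale R L
  surjective : Function.Surjective (algebraMap R (L ⧸ I))
  le_map_under : I ≤ (I.under R).map (algebraMap R L)

theorem IsEtaleNeighbourhood.map_away {R L : Type*} [CommRing R] [CommRing L] [Algebra R L]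
    [Algebra.Etale R L] {I : Ideal L} (hI : Function.Surjective (algebraMap R (L ⧸ I)))
    {w : L} (hw : w - 1 ∈ I) (hwI : ∀ x ∈ I, w * x ∈ (I.under R).map (algebraMap R L))
    (L' : Type*) [CommRing L'] [Algebra L L'] [Algebra R L'] [IsScalarTower R L L']
    [IsLocalization.Away w L'] : IsEtaleNeighbourhood R (I.map (algebraMap L L')) where
  etale :=
    have : Algebra.Etale L L' := .of_isLocalizationAway w
    .comp R L L'
  surjective := by
    have := isLocalization_away_quotient_map (L' := L') I w
    rw [Ideal.Quotient.eq.2 hw, map_one, ← map_one (algebraMap R (L ⧸ I))] at this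
    have : IsScalarTower R L (L' ⧸ I.map (algebraMap L L')) := .to₁₂₄ R L L' _
    have : IsScalarTower R (L ⧸ I) (L' ⧸ I.map (algebraMap L L')) := .to₁₃₄ R L _ _
    have : IsLocalization.Away (1 : R) R :=
      IsLocalization.away_of_isUnit_of_bijective R isUnit_one Function.bijective_id
    exact surjective_algebraMap_of_away (S := L ⧸ I) (r := (1 : R)) fun y ↦ by
      rw [one_smul]
      exact (hI y).imp fun _ ↦ Eq.symm
  le_map_under := by
    have hunder : I.under R ≤ (I.map (algebraMap L L')).under R := fun r hr ↦ by
      rw [Ideal.mem_under, IsScalarTower.algebraMap_apply R L L']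
      exact Ideal.mem_map_of_mem _ hr
    refine Ideal.map_le_iff_le_comap.2 fun x hx ↦ ?_
    have hunit : IsUnit (algebraMap L L' w) := IsLocalization.Away.algebraMap_isUnit w
    rw [Ideal.mem_comap, ← Ideal.unit_mul_mem_iff_mem _ hunit, ← map_mul]
    refine Ideal.map_mono hunder ?_
    rw [IsScalarTower.algebraMap_eq R L L', ← Ideal.map_map]
    exact Ideal.mem_map_of_mem _ (hwI x hx)

end EtaleNeighbourhoods

section EtaleCoordinates

/-- A neighbourhood of the zero locus of `K` in `Spec B` is an étale neighbourhood of its closed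
subscheme cut out by `I` over a principal open subset of the affine line over `A`. The
neighbourhood is `Spec L`, and the principal open subset is the locus where `r` does not vanish. -/
def HasEtaleCoordinate (A : Type u) {B : Type u} [CommRing A] [CommRing B] [Algebra A B]
    (K I : Ideal B) : Prop :=
  ∃ (r : A[X]) (L : Type u) (_ : CommRing L) (_ : Algebra A L) (_ : Algebra B L)
    (_ : IsScalarTower A B L) (_ : Algebra (Localization.Away r) L)
    (_ : IsScalarTower A (Localization.Away r) L),
    Algebra.IsStandardOpenImmersion B L ∧
    PrimeSpectrum.zeroLocus K ⊆ Set.range (PrimeSpectrum.comap (algebraMap B L)) ∧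
    IsEtaleNeighbourhood (Localization.Away r) (I.map (algebraMap B L))

variable {A B : Type u} [CommRing A] [CommRing B] [Algebra A B]

theorem IsEtaleNeighbourhood.hasEtaleCoordinate {r : A[X]} [Algebra (Localization.Away r) B]
    [IsScalarTower A (Localization.Away r) B] {I : Ideal B}
    (hI : IsEtaleNeighbourhood (Localization.Away r) I) (K : Ideal B) :
    HasEtaleCoordinate A K I := by
  refine ⟨r, B, _, _, .id B, inferInstance, _, inferInstance, inferInstance, ?_, ?_⟩
  · simp
  · rwa [Algebra.algebraMap_self, Ideal.map_id]

theorem zeroLocus_subset_image_comap_of_away {L : Type*} [CommRing L] [Algebra B L] {K : Ideal B}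
    {b : B} (hb : b - 1 ∈ K) [IsLocalization.Away b L] : PrimeSpectrum.zeroLocus (K : Set B) ⊆
      PrimeSpectrum.comap (algebraMap B L) '' PrimeSpectrum.zeroLocus (K.map (algebraMap B L)) := by
  intro P hP
  obtain ⟨Q, rfl⟩ : P ∈ Set.range (PrimeSpectrum.comap (algebraMap B L)) := by
    rw [PrimeSpectrum.localization_away_comap_range L b]
    intro hbP
    refine P.2.ne_top ((Ideal.eq_top_iff_one _).2 ?_)
    simpa using sub_mem hbP (hP hb)
  exact ⟨Q, Ideal.map_le_iff_le_comap.2 hP, rfl⟩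

theorem HasEtaleCoordinate.of_away {K I : Ideal B} {b : B} (hb : b - 1 ∈ K) (L : Type u)
    [CommRing L] [Algebra A L] [Algebra B L] [IsScalarTower A B L] [IsLocalization.Away b L]
    (h : HasEtaleCoordinate A (K.map (algebraMap B L)) (I.map (algebraMap B L))) :
    HasEtaleCoordinate A K I := by
  obtain ⟨r, L', _, _, _, _, _, _, hL', hK, hI⟩ := h
  let := Algebra.compHom L' (algebraMap B L)
  have : IsScalarTower B L L' := .of_algebraMap_eq' rfl
  have : IsScalarTower A B L' := .to₁₂₄ A B L L'
  have : Algebra.IsStandardOpenImmersion B L := ⟨b, inferInstance⟩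
  refine ⟨r, L', _, _, _, inferInstance, _, inferInstance, .trans B L L', ?_, ?_⟩
  · refine (zeroLocus_subset_image_comap_of_away (L := L) hb).trans ((Set.image_mono hK).trans ?_)
    rw [IsScalarTower.algebraMap_eq B L L', PrimeSpectrum.comap_comp]
    exact (Set.range_comp _ _).ge
  · rwa [Ideal.map_map, ← IsScalarTower.algebraMap_eq] at hI

end EtaleCoordinates

section QuotientByIdeal

variable {A B : Type*} [CommRing A] [CommRing B] [Algebra A B] {J : Ideal A} {I : Ideal B}

theorem mk_mem_map_algebraMap_iff {x : B} :
    Ideal.Quotient.mk I x ∈ J.map (algebraMap A (B ⧸ I)) ↔ x ∈ I ⊔ J.map (algebraMap A B) := by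
  rw [IsScalarTower.algebraMap_eq A B (B ⧸ I), ← Ideal.map_map, Ideal.Quotient.algebraMap_eq,
    ← Ideal.mem_comap, Ideal.comap_map_of_surjective' _ Ideal.Quotient.mk_surjective, Ideal.mk_ker,
    sup_comm]

theorem isGeneratorMod_mk_iff {t : B} :
    IsGeneratorMod A (J.map (algebraMap A (B ⧸ I))) (Ideal.Quotient.mk I t) ↔
      IsGeneratorMod A (I ⊔ J.map (algebraMap A B)) t := by
  have haeval (p : A[X]) : aeval (Ideal.Quotient.mk I t) p = Ideal.Quotient.mk I (aeval t p) :=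
    aeval_algHom_apply (Ideal.Quotient.mkₐ A I) t p
  refine Ideal.Quotient.mk_surjective.forall.trans (forall_congr' fun x ↦ exists_congr fun p ↦ ?_)
  rw [haeval, ← map_sub, mk_mem_map_algebraMap_iff]

theorem isArtinianRing_quotient_sup_map [IsArtinianRing (A ⧸ J)] [Algebra.QuasiFinite A (B ⧸ I)] :
    IsArtinianRing (B ⧸ I ⊔ J.map (algebraMap A B)) := by
  have : Algebra.QuasiFinite (A ⧸ J) ((B ⧸ I) ⧸ J.map (algebraMap A (B ⧸ I))) :=
    .of_restrictScalars A _ _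
  have : Module.Finite (A ⧸ J) ((B ⧸ I) ⧸ J.map (algebraMap A (B ⧸ I))) := .of_quasiFinite
  have : IsArtinianRing ((B ⧸ I) ⧸ J.map (algebraMap A (B ⧸ I))) := .of_finite (A ⧸ J) _
  have e := DoubleQuot.quotQuotEquivQuotSup I (J.map (algebraMap A B))
  rw [Ideal.map_map] at e
  exact e.surjective.isArtinianRing

end QuotientByIdeal

section Assembly

theorem exists_sub_one_mem_and_sub_algebraMap_mem {R B : Type*} [CommRing R] [CommRing B]
    [Algebra R B] {J : Ideal R} {I K : Ideal B} [Module.Finite R (B ⧸ I)]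
    (hK : K = I ⊔ J.map (algebraMap R B)) (hgen : ∀ x, ∃ p, x - algebraMap R B p ∈ K) {h : B}
    (hh : h - 1 ∈ K) :
    ∃ (s : R) (F : B), F - 1 ∈ K ∧ F - algebraMap R B s ∈ I ∧ h ∣ F ∧ algebraMap R B s ∣ F ^ 2 ∧
      ∀ y : B ⧸ I, ∃ p, s • y = algebraMap R (B ⧸ I) p := by
  obtain ⟨r, hr, hrS⟩ := exists_sub_one_mem_and_forall_smul_eq_algebraMap (S := B ⧸ I) (I := J)
    (Ideal.Quotient.mk_surjective.forall.2 fun x ↦ (hgen x).imp fun p hp ↦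
      mk_mem_map_algebraMap_iff.2 (hK ▸ hp))
  obtain ⟨p, hp⟩ := hrS (Ideal.Quotient.mk I h)
  let φ := algebraMap R B
  have hpI : φ r * h - φ p ∈ I := Ideal.Quotient.eq.1 <|
    (map_mul _ _ _).trans ((Algebra.smul_def r (Ideal.Quotient.mk I h)).symm.trans hp)
  have hhK : Ideal.Quotient.mk K h = 1 := Ideal.Quotient.eq.2 hh
  have hrK : Ideal.Quotient.mk K (φ r) = 1 := by
    refine Ideal.Quotient.eq.2 (hK ▸ Ideal.mem_sup_right ?_)
    rw [← map_one φ, ← map_sub]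
    exact Ideal.mem_map_of_mem φ hr
  have hpK : Ideal.Quotient.mk K (φ p) = 1 := by
    rw [← Ideal.Quotient.eq.2 (hK ▸ Ideal.mem_sup_left hpI : φ r * h - φ p ∈ K), map_mul, hrK, hhK,
      one_mul]
  refine ⟨p ^ 2, φ r * h * φ p, Ideal.Quotient.eq.1 ?_, ?_, ⟨φ r * φ p, by ring⟩,
    ⟨(φ r * h) ^ 2, by rw [map_pow]; ring⟩, fun y ↦ ?_⟩
  · rw [map_mul, map_mul, hrK, hhK, hpK, one_mul, one_mul, map_one]
  · rw [map_pow, pow_two, ← sub_mul]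
    exact I.mul_mem_right _ hpI
  · obtain ⟨q, hq⟩ := hrS (Ideal.Quotient.mk I h * y)
    have hpy : p • y = algebraMap R (B ⧸ I) q := by
      rw [← hq, ← smul_mul_assoc, hp, Algebra.smul_def]
    exact ⟨p * q, by rw [pow_two, mul_smul, hpy, Algebra.smul_def, map_mul]⟩

variable {A : Type u} [CommRing A]

theorem hasEtaleCoordinate_of_surjective {L : Type u} [CommRing L] [Algebra A L] (r : A[X])
    [Algebra (Localization.Away r) L] [IsScalarTower A (Localization.Away r) L]
    [Algebra.Etale (Localization.Away r) L] {I K : Ideal L} (hIK : I ≤ K)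
    (hsurj : Function.Surjective (algebraMap (Localization.Away r) (L ⧸ I))) :
    HasEtaleCoordinate A K I := by
  obtain ⟨w, hw, hwI⟩ := exists_sub_one_mem_and_forall_mul_mem_map_under hsurj
  exact .of_away (hIK hw) (Localization.Away w)
    ((IsEtaleNeighbourhood.map_away hsurj hw hwI _).hasEtaleCoordinate _)

variable {B : Type u} [CommRing B] [Algebra A B] [Algebra.Smooth A B]

theorem hasEtaleCoordinate_of_away [Algebra A[X] B] [IsScalarTower A A[X] B]
    (hrk : ∀ p, Module.rankAtStalk (R := B) Ω[B⁄A] p = 1) {I K : Ideal B} (hIK : I ≤ K) {F h : B}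
    (hF : F - 1 ∈ K) {s : A[X]} (hFs : F - algebraMap A[X] B s ∈ I) (hhF : h ∣ F)
    (hsF : algebraMap A[X] B s ∣ F ^ 2) (hh : ∀ ω : Ω[B⁄A[X]], h • ω = 0)
    (hs : ∀ y : B ⧸ I, ∃ p, s • y = algebraMap A[X] (B ⧸ I) p) : HasEtaleCoordinate A K I := by
  let L := Localization.Away F
  have hFL : IsUnit (algebraMap B L F) := IsLocalization.Away.algebraMap_isUnit F
  have hhL : IsUnit (algebraMap B L h) := isUnit_of_dvd_unit (map_dvd _ hhF) hFL
  have hsL : IsUnit (algebraMap A[X] L s) := by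
    rw [IsScalarTower.algebraMap_apply A[X] B L]
    exact isUnit_of_dvd_unit (map_dvd _ hsF) (by rw [map_pow]; exact hFL.pow 2)
  let R' := Localization.Away s
  let f : R' →ₐ[A[X]] L := IsLocalization.Away.liftAlgHom s (f := Algebra.ofId A[X] L) hsL
  let := f.toRingHom.toAlgebra
  have : IsScalarTower A[X] R' L := .of_algebraMap_eq' f.comp_algebraMap.symm
  have : IsScalarTower A R' L := .to₁₃₄ A A[X] R' L
  have : Algebra.Etale B L := .of_isLocalizationAway F
  have : Algebra.Smooth A L := .comp A B L
  have : Algebra.FormallyUnramified A[X] L :=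
    formallyUnramified_of_smul_kaehlerDifferential_eq_zero hhL hh
  have : Algebra.FormallyUnramified R' L := .of_restrictScalars A[X] R' L
  have : Algebra.Etale R' L := etale_away_polynomial s fun q ↦ by
    rw [rankAtStalk_kaehlerDifferential_of_formallyEtale (B := B), hrk]
  refine .of_away hF L (hasEtaleCoordinate_of_surjective s (Ideal.map_mono hIK) ?_)
  have := isLocalization_away_quotient_map (L' := L) I F
  rw [Ideal.Quotient.eq.2 hFs] at this
  have : IsScalarTower A[X] B (L ⧸ I.map (algebraMap B L)) := .to₁₂₄ A[X] B L _
  have : IsScalarTower A[X] (B ⧸ I) (L ⧸ I.map (algebraMap B L)) := .to₁₃₄ A[X] B _ _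
  exact surjective_algebraMap_of_away (S := B ⧸ I) (r := s) hs

theorem IsGeneratorMod.hasEtaleCoordinate
    (hrk : ∀ p, Module.rankAtStalk (R := B) Ω[B⁄A] p = 1) {J : Ideal A}
    [IsArtinianRing (A ⧸ J)] {I : Ideal B} [Algebra.QuasiFinite A (B ⧸ I)] {t : B}
    (ht : IsGeneratorMod A (I ⊔ J.map (algebraMap A B)) t)
    (hint : (aeval (Ideal.Quotient.mk I t) : A[X] →ₐ[A] B ⧸ I).toRingHom.IsIntegral) :
    HasEtaleCoordinate A (I ⊔ J.map (algebraMap A B)) I := by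
  have : IsArtinianRing (B ⧸ I ⊔ J.map (algebraMap A B)) := isArtinianRing_quotient_sup_map
  obtain ⟨s, hs, h, hh, hspan⟩ := ht.exists_smul_mem_span_D_add hrk rfl
  have hu := ht.of_sub_mem (t' := t + s) (by simpa using Ideal.mem_sup_left hs)
  have hmk : Ideal.Quotient.mk I t = Ideal.Quotient.mk I (t + s) := by
    rw [map_add, Ideal.Quotient.eq_zero_iff_mem.2 hs, add_zero]
  rw [hmk] at hint
  let := (aeval (t + s) : A[X] →ₐ[A] B).toRingHom.toAlgebra
  have : IsScalarTower A A[X] B := .of_algebraMap_eq' (aeval (t + s)).comp_algebraMap.symm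
  have haeval : algebraMap A[X] (B ⧸ I) = (aeval (Ideal.Quotient.mk I (t + s))).toRingHom :=
    congrArg AlgHom.toRingHom (aeval_algHom (Ideal.Quotient.mkₐ A I) (t + s)).symm
  have : Algebra.IsIntegral A[X] (B ⧸ I) := algebraMap_isIntegral_iff.1 (haeval ▸ hint)
  have : Algebra.FiniteType A[X] (B ⧸ I) := .of_restrictScalars_finiteType A _ _
  have : Module.Finite A[X] (B ⧸ I) := Algebra.IsIntegral.finite
  have hX : algebraMap A[X] B X = t + s := aeval_X _
  obtain ⟨r, F, hF, hFr, hhF, hrF, hr⟩ :=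
    exists_sub_one_mem_and_sub_algebraMap_mem (J := J.map (algebraMap A A[X])) (by
      rw [Ideal.map_map, ← IsScalarTower.algebraMap_eq]) hu hh
  exact hasEtaleCoordinate_of_away hrk le_sup_left hF hFr hhF hrF
    (smul_kaehlerDifferential_eq_zero (A := A) (x := X) (by simpa only [hX] using hspan)) hr

theorem hasEtaleCoordinate_of_quasiFinite
    (hrk : ∀ p, Module.rankAtStalk (R := B) Ω[B⁄A] p = 1) {J : Ideal A}
    [IsArtinianRing (A ⧸ J)] {I : Ideal B} [Algebra.QuasiFinite A (B ⧸ I)]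
    (hgen : ∃ t, IsGeneratorMod A (J.map (algebraMap A (B ⧸ I))) t) :
    HasEtaleCoordinate A (I ⊔ J.map (algebraMap A B)) I := by
  obtain ⟨t, ht⟩ := hgen
  obtain ⟨b, hb, hint⟩ := exists_sub_one_mem_and_isIntegral_pow_mul (S := B ⧸ I) J
  obtain ⟨b, rfl⟩ := Ideal.Quotient.mk_surjective b
  let L := Localization.Away b
  have hbK : b - 1 ∈ I ⊔ J.map (algebraMap A B) := by
    rwa [← mk_mem_map_algebraMap_iff, map_sub, map_one]
  have := isLocalization_away_quotient_map (L' := L) I b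
  have : IsScalarTower A B (L ⧸ I.map (algebraMap B L)) := .to₁₂₄ A B L _
  have : IsScalarTower A (B ⧸ I) (L ⧸ I.map (algebraMap B L)) := .to₁₃₄ A B _ _
  obtain ⟨t₁, ht₁, hint₁⟩ := exists_isGeneratorMod_and_isIntegral_aeval
    (L ⧸ I.map (algebraMap B L)) _ J hb hint ht
  obtain ⟨t₁, rfl⟩ := Ideal.Quotient.mk_surjective t₁
  have : Algebra.Etale B L := .of_isLocalizationAway b
  have : Algebra.Smooth A L := .comp A B L
  have : Algebra.QuasiFinite A (L ⧸ I.map (algebraMap B L)) :=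
    .of_isLocalization (.powers (Ideal.Quotient.mk I b))
  refine .of_away hbK L ?_
  rw [Ideal.map_sup, Ideal.map_map, ← IsScalarTower.algebraMap_eq]
  exact (isGeneratorMod_mk_iff.1 ht₁).hasEtaleCoordinate (fun q ↦ by
    rw [rankAtStalk_kaehlerDifferential_of_formallyEtale (B := B), hrk]) hint₁

end Assembly

section RelativeDimension

theorem rankAtStalk_kaehlerDifferential_of_locally {A B : Type u} [CommRing A] [CommRing B]
    [Algebra A B] [Algebra.Smooth A B] {n : ℕ}
    (h : RingHom.Locally (fun f ↦ RingHom.IsStandardSmoothOfRelativeDimension n f)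
      (algebraMap A B)) (p : PrimeSpectrum B) :
    Module.rankAtStalk (R := B) Ω[B⁄A] p = n := by
  obtain ⟨s, hs, hloc⟩ := h
  obtain ⟨t, hts, htp⟩ : ∃ t ∈ s, t ∉ p.asIdeal := by
    by_contra! hcon
    exact p.2.ne_top (eq_top_iff.2 (hs ▸ Ideal.span_le.2 hcon))
  let L := Localization.Away t
  have hL : Algebra.IsStandardSmoothOfRelativeDimension n A L := by
    rw [← RingHom.isStandardSmoothOfRelativeDimension_algebraMap, IsScalarTower.algebraMap_eq A B L]
    exact hloc t hts
  have := Algebra.IsStandardSmoothOfRelativeDimension.isStandardSmooth (R := A) (S := L) n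
  obtain ⟨q, rfl⟩ : p ∈ Set.range (PrimeSpectrum.comap (algebraMap B L)) := by
    rwa [PrimeSpectrum.localization_away_comap_range L t]
  have : Nontrivial L := q.nontrivial
  have : Algebra.Etale B L := .of_isLocalizationAway t
  rw [← rankAtStalk_kaehlerDifferential_of_formallyEtale, Module.rankAtStalk_eq_finrank_of_free,
    Module.finrank, Algebra.IsStandardSmoothOfRelativeDimension.rank_kaehlerDifferential n]
  simp

end RelativeDimension

section Squares

theorem isPushout_of_surjective {R S R' S' : CommRingCat.{u}} {f : R ⟶ S} {π : R ⟶ R'}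
    {π' : S ⟶ S'} {f' : R' ⟶ S'} (w : f ≫ π' = π ≫ f') (hπ : Function.Surjective π)
    (hπ' : Function.Surjective π') (hker : RingHom.ker π'.hom ≤ (RingHom.ker π.hom).map f.hom) :
    IsPushout f π π' f' := by
  have hle (s : PushoutCocone f π) : RingHom.ker π'.hom ≤ RingHom.ker s.inl.hom := by
    refine hker.trans (Ideal.map_le_iff_le_comap.2 fun x hx ↦ ?_)
    have hs := congr($(s.condition).hom x)
    simp only [CommRingCat.hom_comp, RingHom.comp_apply, (RingHom.mem_ker).1 hx, map_zero] at hs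
    exact hs
  let desc (s : PushoutCocone f π) : S' ⟶ s.pt :=
    CommRingCat.ofHom (RingHom.liftOfSurjective π'.hom hπ' ⟨s.inl.hom, hle s⟩)
  have hdesc (s : PushoutCocone f π) : π' ≫ desc s = s.inl := by
    ext x
    exact RingHom.liftOfRightInverse_comp_apply _ _ (Function.rightInverse_surjInv hπ') _ x
  have : Epi π' := ConcreteCategory.epi_of_surjective π' hπ'
  have : Epi π := ConcreteCategory.epi_of_surjective π hπ
  refine ⟨⟨w⟩, ⟨PushoutCocone.IsColimit.mk _ desc hdesc (fun s ↦ ?_) fun s m hm _ ↦ ?_⟩⟩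
  · rw [← cancel_epi π, ← reassoc_of% w, hdesc, s.condition]
  · rw [← cancel_epi π', hm, hdesc]

theorem isPullback_Spec_quotientMk {R S : Type u} [CommRing R] [CommRing S] (f : R →+* S)
    (I : Ideal R) :
    IsPullback (Spec.map (CommRingCat.ofHom (Ideal.Quotient.mk (I.map f))))
      (Spec.map (CommRingCat.ofHom (Ideal.quotientMap (I.map f) f Ideal.le_comap_map)))
      (Spec.map (CommRingCat.ofHom f)) (Spec.map (CommRingCat.ofHom (Ideal.Quotient.mk I))) :=
  isPullback_SpecMap_of_isPushout _ _ _ _ <|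
    isPushout_of_surjective (by ext; rfl) Ideal.Quotient.mk_surjective Ideal.Quotient.mk_surjective
      (by simp only [CommRingCat.hom_ofHom, Ideal.mk_ker, le_refl])

theorem IsEtaleNeighbourhood.isPullback {R L : Type u} [CommRing R] [CommRing L] [Algebra R L]
    {I : Ideal L} (hI : IsEtaleNeighbourhood R I) :
    IsPullback (Spec.map (CommRingCat.ofHom (Ideal.Quotient.mk I)))
      (𝟙 (Spec (CommRingCat.of (L ⧸ I)))) (Spec.map (CommRingCat.ofHom (algebraMap R L)))
      (Spec.map (CommRingCat.ofHom (algebraMap R (L ⧸ I)))) := by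
  rw [← Spec.map_id]
  refine isPullback_SpecMap_of_isPushout _ _ _ _ <|
    isPushout_of_surjective (by ext; rfl) hI.surjective Ideal.Quotient.mk_surjective ?_
  rw [CommRingCat.hom_ofHom, CommRingCat.hom_ofHom, CommRingCat.hom_ofHom, Ideal.mk_ker,
    IsScalarTower.algebraMap_eq R L (L ⧸ I), ← RingHom.comap_ker, Ideal.Quotient.algebraMap_eq,
    Ideal.mk_ker]
  exact hI.le_map_under

theorem exists_isPullback_morphismRestrict {C X Y U W Z Z' : Scheme.{u}} {i : Y ⟶ C} {g : U ⟶ C}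
    [IsOpenImmersion g] {k : Z ⟶ U} {y : Z ⟶ Y} (hY : IsPullback k y g i) (v : W ⟶ X)
    [IsOpenImmersion v] {ψ : U ⟶ W} {e : Z ⟶ Z'} [IsIso e] {j : Z' ⟶ W}
    (h : IsPullback k e ψ j) :
    ∃ e' : (i ⁻¹ᵁ g.opensRange).toScheme ⟶ Z', IsIso e' ∧
      IsPullback (i ∣_ g.opensRange) e' (g.isoOpensRange.inv ≫ ψ ≫ v.isoOpensRange.hom)
        (j ≫ v.isoOpensRange.hom) := by
  have hY' : IsPullback (k ≫ g.isoOpensRange.hom) y g.opensRange.ι i :=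
    hY.of_iso (Iso.refl _) g.isoOpensRange (Iso.refl _) (Iso.refl _)
      (by simp) (by simp) (by simp) (by simp)
  let z := hY'.isoIsPullback _ _ (isPullback_morphismRestrict i g.opensRange)
  have hz : z.hom ≫ (i ∣_ g.opensRange) = k ≫ g.isoOpensRange.hom :=
    hY'.isoIsPullback_hom_fst _ _ _
  exact ⟨z.inv ≫ e, inferInstance,
    h.of_iso z g.isoOpensRange (Iso.refl _) v.isoOpensRange hz.symm (by simp) (by simp) (by simp)⟩

end Squares

section AffineLine

/-- The affine line over `Spec R` is the spectrum of the polynomial ring. -/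
def affineLineIso (R : Type u) [CommRing R] : affineLine R ≅ Spec (CommRingCat.of R[X]) :=
  AffineSpace.SpecIso PUnit.{u + 1} (CommRingCat.of R) ≪≫ Scheme.Spec.mapIso
    (MvPolynomial.uniqueAlgEquiv R PUnit.{u + 1}).symm.toRingEquiv.toCommRingCatIso.op

theorem affineLineIso_inv_over (R : Type u) [CommRing R] :
    (affineLineIso R).inv ≫ affineLineToSpec R =
      Spec.map (CommRingCat.ofHom (algebraMap R R[X])) := by
  rw [affineLineIso, Iso.trans_inv, Category.assoc, AffineSpace.SpecIso_inv_over,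
    Functor.mapIso_inv, Scheme.Spec_map, ← Spec.map_comp]
  congr 1
  ext x
  simp

theorem affineLineIso_hom_over (R : Type u) [CommRing R] :
    (affineLineIso R).hom ≫ Spec.map (CommRingCat.ofHom (algebraMap R R[X])) =
      affineLineToSpec R := by
  rw [← affineLineIso_inv_over, Iso.hom_inv_id_assoc]

theorem surjective_of_isClosedImmersion_Spec_map {R S : CommRingCat.{u}} (f : R ⟶ S)
    [IsClosedImmersion (Spec.map f)] : Function.Surjective f := by
  have hf : f = (Scheme.ΓSpecIso R).inv ≫ (Spec.map f).appTop ≫ (Scheme.ΓSpecIso S).hom := by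
    rw [Scheme.ΓSpecIso_naturality, Iso.inv_hom_id_assoc]
  rw [hf]
  exact ((ConcreteCategory.bijective_of_isIso (Scheme.ΓSpecIso S).hom).2.comp
    (IsClosedImmersion.isAffine_surjective_of_isAffine (Spec.map f)).2).comp
    (ConcreteCategory.bijective_of_isIso (Scheme.ΓSpecIso R).inv).2

theorem exists_surjective_aeval_of_isClosedImmersion {k S : Type u} [CommRing k] [CommRing S]
    [Algebra k S] (ι : Spec (CommRingCat.of S) ⟶ affineLine k) [IsClosedImmersion ι]
    (hι : ι ≫ affineLineToSpec k = Spec.map (CommRingCat.ofHom (algebraMap k S))) :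
    ∃ τ : S, Function.Surjective (aeval τ : k[X] →ₐ[k] S) := by
  obtain ⟨θ, hθ⟩ := Spec.map_surjective (ι ≫ (affineLineIso k).hom)
  have hC : CommRingCat.ofHom (algebraMap k k[X]) ≫ θ = CommRingCat.ofHom (algebraMap k S) := by
    rw [← Spec.map_inj, Spec.map_comp, hθ, Category.assoc, affineLineIso_hom_over, hι]
  have haeval : (aeval (θ.hom X) : k[X] →ₐ[k] S).toRingHom = θ.hom :=
    Polynomial.ringHom_ext (fun a ↦ by simpa using congr($(hC.symm).hom a)) (by simp)
  have : IsClosedImmersion (Spec.map θ) := by rw [hθ]; infer_instance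
  exact ⟨θ.hom X, fun s ↦ (surjective_of_isClosedImmersion_Spec_map θ s).imp fun p hp ↦
    congr($haeval p).trans hp⟩

theorem exists_isGeneratorMod_of_isClosedImmersion {A S : Type u} [CommRing A] [CommRing S]
    [Algebra A S] {m : MaximalSpectrum A} {Y : Scheme.{u}} {q : Y ⟶ Spec (CommRingCat.of A)}
    {y : Y ≅ Spec (CommRingCat.of S)}
    (hy : y.hom ≫ Spec.map (CommRingCat.ofHom (algebraMap A S)) = q)
    (ι : closedFibre q m ⟶ affineLine (A ⧸ m.asIdeal)) [IsClosedImmersion ι]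
    (hι : ι ≫ affineLineToSpec (A ⧸ m.asIdeal) = closedFibreToSpec q m) :
    ∃ τ : S, IsGeneratorMod A (m.asIdeal.map (algebraMap A S)) τ := by
  let mS := m.asIdeal.map (algebraMap A S)
  have hfib : IsPullback (Spec.map (CommRingCat.ofHom (Ideal.Quotient.mk mS)) ≫ y.inv)
      (Spec.map (CommRingCat.ofHom (algebraMap (A ⧸ m.asIdeal) (S ⧸ mS)))) q (closedPoint m) :=
    (isPullback_Spec_quotientMk (algebraMap A S) m.asIdeal).of_iso
      (Iso.refl _) y.symm (Iso.refl _) (Iso.refl _) (by simp) (by simp) (by simp [← hy]) (by simp)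
  obtain ⟨τ, hτ⟩ := exists_surjective_aeval_of_isClosedImmersion (hfib.isoPullback.hom ≫ ι) (by
    rw [Category.assoc, hι]
    exact hfib.isoPullback_hom_snd)
  obtain ⟨τ, rfl⟩ := Ideal.Quotient.mk_surjective τ
  refine ⟨τ, fun s ↦ ?_⟩
  obtain ⟨p, hp⟩ := hτ (Ideal.Quotient.mk mS s)
  obtain ⟨p, rfl⟩ := Polynomial.map_surjective _ Ideal.Quotient.mk_surjective p
  refine ⟨p, Ideal.Quotient.eq.1 ?_⟩
  have haeval : aeval (Ideal.Quotient.mk mS τ) p = Ideal.Quotient.mk mS (aeval τ p) :=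
    aeval_algHom_apply (Ideal.Quotient.mkₐ A mS) τ p
  rw [← hp, ← haeval]
  exact aeval_map_algebraMap (A ⧸ m.asIdeal) _ p

end AffineLine

section AffineModels

variable {A B : Type u} [CommRing A] [CommRing B] [Algebra A B] {C Y : Scheme.{u}}
  {p : C ⟶ Spec (CommRingCat.of A)} {i : Y ⟶ C} {c : C ≅ Spec (CommRingCat.of B)} {I : Ideal B}
  {y : Y ≅ Spec (CommRingCat.of (B ⧸ I))}

theorem le_asIdeal_Spec_map_quotientMk {R : Type u} [CommRing R] (I : Ideal R)
    (x : Spec (CommRingCat.of (R ⧸ I))) :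
    I ≤ (Spec.map (CommRingCat.ofHom (Ideal.Quotient.mk I)) x).asIdeal := fun a ha ↦ by
  change Ideal.Quotient.mk I a ∈ x.asIdeal
  rw [Ideal.Quotient.eq_zero_iff_mem.2 ha]
  exact zero_mem _

theorem apply_mem_zeroLocus_of_mem_range_closedFibreι
    (hc : c.hom ≫ Spec.map (CommRingCat.ofHom (algebraMap A B)) = p)
    (hy : i ≫ c.hom = y.hom ≫ Spec.map (CommRingCat.ofHom (Ideal.Quotient.mk I)))
    {J : Ideal A} {m : MaximalSpectrum A} (hJm : J ≤ m.asIdeal) {x : C}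
    (hx : x ∈ Set.range (closedFibreι (i ≫ p) m ≫ i)) :
    c.hom x ∈ PrimeSpectrum.zeroLocus ((I ⊔ J.map (algebraMap A B) : Ideal B) : Set B) := by
  obtain ⟨x, rfl⟩ := hx
  have hfib : closedFibreι (i ≫ p) m ≫ i ≫ c.hom ≫
      Spec.map (CommRingCat.ofHom (algebraMap A B)) =
        closedFibreToSpec (i ≫ p) m ≫ closedPoint m := by
    rw [hc, pullback.condition]
  refine sup_le (α := Ideal B) ?_ (Ideal.map_le_iff_le_comap.2 ?_)
  · rw [← Scheme.Hom.comp_apply, Category.assoc, hy, ← Category.assoc, Scheme.Hom.comp_apply]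
    exact le_asIdeal_Spec_map_quotientMk I _
  · change J ≤ (Spec.map (CommRingCat.ofHom (algebraMap A B)) _).asIdeal
    rw [← Scheme.Hom.comp_apply, ← Scheme.Hom.comp_apply, Category.assoc, hfib,
      Scheme.Hom.comp_apply]
    exact hJm.trans (le_asIdeal_Spec_map_quotientMk m.asIdeal _)

theorem HasEtaleCoordinate.exists_opens {K : Ideal B} (h : HasEtaleCoordinate A K I)
    (hc : c.hom ≫ Spec.map (CommRingCat.ofHom (algebraMap A B)) = p)
    (hy : i ≫ c.hom = y.hom ≫ Spec.map (CommRingCat.ofHom (Ideal.Quotient.mk I))) :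
    ∃ (C' : C.Opens) (V : (affineLine A).Opens) (f : C'.toScheme ⟶ V.toScheme)
      (Y' : Scheme.{u}) (j : Y' ⟶ V.toScheme) (e : (i ⁻¹ᵁ C').toScheme ⟶ Y'),
      IsAffineOpen C' ∧
      (∀ x, c.hom x ∈ PrimeSpectrum.zeroLocus (K : Set B) → x ∈ C') ∧
      IsAffineOpen V ∧
      Etale f ∧
      f ≫ V.ι ≫ affineLineToSpec A = C'.ι ≫ p ∧
      IsClosedImmersion j ∧
      IsIso e ∧
      IsPullback (i ∣_ C') e f j := by
  obtain ⟨r, L, _, _, _, _, _, _, hBL, hK, hI⟩ := h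
  let R' := Localization.Away r
  have : IsOpenImmersion (Spec.map (CommRingCat.ofHom (algebraMap B L))) := by
    obtain ⟨b, hb⟩ := hBL.exists_away
    exact IsOpenImmersion.of_isLocalization b
  have : IsOpenImmersion (Spec.map (CommRingCat.ofHom (algebraMap A[X] R'))) :=
    IsOpenImmersion.of_isLocalization r
  let g : Spec (CommRingCat.of L) ⟶ C := Spec.map (CommRingCat.ofHom (algebraMap B L)) ≫ c.inv
  let v : Spec (CommRingCat.of R') ⟶ affineLine A :=
    Spec.map (CommRingCat.ofHom (algebraMap A[X] R')) ≫ (affineLineIso A).inv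
  have hover : Spec.map (CommRingCat.ofHom (algebraMap R' L)) ≫ v ≫ affineLineToSpec A = g ≫ p := by
    simp only [v, g, ← hc, Category.assoc, affineLineIso_inv_over, Iso.inv_hom_id_assoc,
      ← Spec.map_comp, ← CommRingCat.ofHom_comp, ← IsScalarTower.algebraMap_eq]
  have hY : IsPullback (Spec.map (CommRingCat.ofHom (Ideal.Quotient.mk (I.map (algebraMap B L)))))
      (Spec.map (CommRingCat.ofHom (Ideal.quotientMap _ (algebraMap B L) Ideal.le_comap_map)) ≫
        y.inv) g i :=
    (isPullback_Spec_quotientMk (algebraMap B L) I).of_iso (Iso.refl _) (Iso.refl _) y.symm c.symm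
      (by simp) (by simp) (by simp [g]) (by simp [Iso.eq_inv_comp, ← reassoc_of% hy])
  obtain ⟨e, he, hpb⟩ := exists_isPullback_morphismRestrict hY v hI.isPullback
  have : IsClosedImmersion (Spec.map (CommRingCat.ofHom (algebraMap R' (L ⧸ I.map _)))) :=
    IsClosedImmersion.spec_of_surjective _ hI.surjective
  have : Etale (Spec.map (CommRingCat.ofHom (algebraMap R' L))) :=
    HasRingHomProperty.Spec_iff.2 (RingHom.etale_algebraMap.2 hI.etale)
  refine ⟨g.opensRange, v.opensRange, _, _, _, e, isAffineOpen_opensRange g, fun x hx ↦ ?_,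
    isAffineOpen_opensRange v, inferInstance, ?_, inferInstance, he, hpb⟩
  · obtain ⟨Q, hQ⟩ := hK hx
    exact ⟨Q, (Scheme.Hom.comp_apply _ c.inv _).trans
      ((congrArg c.inv hQ).trans (Scheme.hom_inv_apply c x))⟩
  · rw [Category.assoc, Category.assoc, Scheme.Hom.isoOpensRange_hom_ι_assoc, hover,
      Scheme.Hom.isoOpensRange_inv_comp_assoc]

theorem exists_affine_model [IsAffine C] (p : C ⟶ Spec (CommRingCat.of A))
    [SmoothOfRelativeDimension 1 p] (i : Y ⟶ C) [IsClosedImmersion i] [LocallyQuasiFinite (i ≫ p)] :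
    ∃ (B : Type u) (_ : CommRing B) (_ : Algebra A B) (c : C ≅ Spec (CommRingCat.of B))
      (I : Ideal B) (y : Y ≅ Spec (CommRingCat.of (B ⧸ I))),
      Algebra.Smooth A B ∧ (∀ P, Module.rankAtStalk (R := B) Ω[B⁄A] P = 1) ∧
      Algebra.QuasiFinite A (B ⧸ I) ∧
      c.hom ≫ Spec.map (CommRingCat.ofHom (algebraMap A B)) = p ∧
      i ≫ c.hom = y.hom ≫ Spec.map (CommRingCat.ofHom (Ideal.Quotient.mk I)) ∧
      y.hom ≫ Spec.map (CommRingCat.ofHom (algebraMap A (B ⧸ I))) = i ≫ p := by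
  obtain ⟨φ, hφ⟩ := Spec.map_surjective (C.isoSpec.inv ≫ p)
  have hdim : SmoothOfRelativeDimension 1 (Spec.map φ) := by
    rw [hφ]
    exact inferInstanceAs (SmoothOfRelativeDimension (0 + 1) (C.isoSpec.inv ≫ p))
  have hsmooth : Smooth (Spec.map φ) := SmoothOfRelativeDimension.smooth 1 _
  rw [HasRingHomProperty.Spec_iff (P := @SmoothOfRelativeDimension 1)] at hdim
  rw [HasRingHomProperty.Spec_iff (P := @Smooth)] at hsmooth
  algebraize [φ.hom]
  obtain ⟨I, y, hy⟩ := IsClosedImmersion.Spec_iff.1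
    (inferInstance : IsClosedImmersion (i ≫ C.isoSpec.hom))
  have hc : C.isoSpec.hom ≫ Spec.map (CommRingCat.ofHom (algebraMap A Γ(C, ⊤))) = p :=
    (Iso.eq_inv_comp _).1 hφ
  have hq : y.hom ≫ Spec.map (CommRingCat.ofHom (algebraMap A (Γ(C, ⊤) ⧸ I))) = i ≫ p := by
    rw [← hc, ← Category.assoc i, hy, Category.assoc, ← Spec.map_comp]
    rfl
  have hqf : LocallyQuasiFinite (Spec.map (CommRingCat.ofHom (algebraMap A (Γ(C, ⊤) ⧸ I)))) := by
    rw [← (Iso.inv_comp_eq y).2 hq.symm]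
    infer_instance
  rw [HasRingHomProperty.Spec_iff (P := @LocallyQuasiFinite)] at hqf
  exact ⟨Γ(C, ⊤), inferInstance, inferInstance, C.isoSpec, I, y, hsmooth,
    rankAtStalk_kaehlerDifferential_of_locally hdim, RingHom.quasiFinite_algebraMap.1 hqf, hc, hy,
    hq⟩

end AffineModels
end Reembed
end

theorem mainTheorem8_general {A : Type u} [CommRing A] {T : Set (MaximalSpectrum A)} (hT : T.Finite)
    {C : Scheme.{u}} [IsAffine C] (p : C ⟶ Spec (CommRingCat.of A))
    [SmoothOfRelativeDimension 1 p]
    {Y : Scheme.{u}} (i : Y ⟶ C) [IsClosedImmersion i] [LocallyQuasiFinite (i ≫ p)]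
    (ι : ∀ m ∈ T, Reembed.closedFibre (i ≫ p) m ⟶ Reembed.affineLine (A ⧸ m.asIdeal))
    (hι_closed : ∀ m hm, IsClosedImmersion (ι m hm))
    (hι_over : ∀ m hm, ι m hm ≫ Reembed.affineLineToSpec (A ⧸ m.asIdeal) =
      Reembed.closedFibreToSpec (i ≫ p) m) :
    ∃ (C' : C.Opens) (V : (Reembed.affineLine A).Opens) (f : C'.toScheme ⟶ V.toScheme)
      (Y' : Scheme.{u}) (j : Y' ⟶ V.toScheme) (e : (i ⁻¹ᵁ C').toScheme ⟶ Y'),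
      IsAffineOpen C' ∧
      (∀ m ∈ T, Set.range (Reembed.closedFibreι (i ≫ p) m ≫ i) ⊆ (C' : Set C)) ∧
      IsAffineOpen V ∧
      Etale f ∧
      f ≫ V.ι ≫ Reembed.affineLineToSpec A = C'.ι ≫ p ∧
      IsClosedImmersion j ∧
      IsIso e ∧
      IsPullback (i ∣_ C') e f j := by
  obtain ⟨B, _, _, c, I, y, _, hrk, _, hc, hy, hq⟩ := Reembed.exists_affine_model p i
  have : Finite T := hT
  have hcop : Pairwise (Function.onFun IsCoprime fun m : T ↦ m.1.asIdeal) := fun m n hmn ↦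
    Ideal.isCoprime_of_isMaximal fun h ↦ hmn (Subtype.ext (MaximalSpectrum.ext h))
  have (m : T) : IsArtinianRing (A ⧸ m.1.asIdeal) :=
    let := Ideal.Quotient.field m.1.asIdeal
    inferInstance
  have := Reembed.isArtinianRing_quotient_iInf hcop
  have hgen (m : T) := have := hι_closed m m.2
    Reembed.exists_isGeneratorMod_of_isClosedImmersion hq (ι m m.2) (hι_over m m.2)
  obtain ⟨C', V, f, Y', j, e, hC', hmem, hV, hf, hover, hj, he, hpb⟩ :=
    (Reembed.hasEtaleCoordinate_of_quasiFinite hrk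
      (Reembed.exists_isGeneratorMod_map_iInf hcop hgen)).exists_opens hc hy
  refine ⟨C', V, f, Y', j, e, hC', fun m hm x hx ↦ hmem x ?_, hV, hf, hover, hj, he, hpb⟩
  have hJm : ⨅ m : T, m.1.asIdeal ≤ m.asIdeal := iInf_le (fun m : T ↦ m.1.asIdeal) ⟨m, hm⟩
  exact Reembed.apply_mem_zeroLocus_of_mem_range_closedFibreι hc hy hJm hx

theorem mainTheorem8 {A : Type u} [CommRing A] [Finite (MaximalSpectrum A)]
    {C : Scheme.{u}} [IsAffine C] (p : C ⟶ Spec (CommRingCat.of A))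
    [SmoothOfRelativeDimension 1 p]
    {Y : Scheme.{u}} (i : Y ⟶ C) [IsClosedImmersion i] [LocallyQuasiFinite (i ≫ p)]
    (ι : ∀ m : MaximalSpectrum A,
      Reembed.closedFibre (i ≫ p) m ⟶ Reembed.affineLine (A ⧸ m.asIdeal))
    (_hι_closed : ∀ m : MaximalSpectrum A, IsClosedImmersion (ι m))
    (_hι_over : ∀ m : MaximalSpectrum A,
      ι m ≫ Reembed.affineLineToSpec (A ⧸ m.asIdeal) =
        Reembed.closedFibreToSpec (i ≫ p) m) :
    ∃ (C' : C.Opens) (V : (Reembed.affineLine A).Opens) (f : C'.toScheme ⟶ V.toScheme)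
      (Y' : Scheme.{u}) (j : Y' ⟶ V.toScheme) (e : (i ⁻¹ᵁ C').toScheme ⟶ Y'),
      IsAffineOpen C' ∧
      (∀ m : MaximalSpectrum A,
        Set.range (Reembed.closedFibreι (i ≫ p) m ≫ i) ⊆ (C' : Set C)) ∧
      IsAffineOpen V ∧
      Etale f ∧
      f ≫ V.ι ≫ Reembed.affineLineToSpec A = C'.ι ≫ p ∧
      IsClosedImmersion j ∧
      IsIso e ∧
      IsPullback (i ∣_ C') e f j := by
  simpa only [Set.mem_univ, forall_const] using mainTheorem8_general Set.finite_univ p i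
    (fun m _ ↦ ι m) (fun m _ ↦ _hι_closed m) fun m _ ↦ _hι_over m
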